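/- Let $m\ge 3$ and $X_m=\{1,\dots,m\}$. The Hanoi automaton $\mathcal{H}_m$ is the Mealy automaton over the alphabet $X_m$ with a trivial state $e$ and one state $a_{(ij)}$ for every transposition $(i,j)$ of $X_m$: in the state $e$ it outputs the letter read and stays in $e$; in the state $a_{(ij)}$, it outputs $j$ on reading $i$ and $i$ on reading $j$, in both cases passing to $e$, and on reading any other letter $x$ it outputs $x$ and stays in $a_{(ij)}$. Every state $s$ defines an invertible transformation $v\mapsto s(v)$ of the set $X_m^*$ of finite words over $X_m$, and these transformations generate, under composition, the Hanoi Towers group $HG_m$. For a state $s$ and $v\in X_m^*$ let $s|_v$ be the state reached from $s$ after reading $v$. A word $w=s_1s_2\cdots s_n$ over the states acts on $X_m^*$ by $w(v)=s_1(s_2(\cdots s_n(v)\cdots))$, and its section at $v\in X_m^*$ is the word $w|_v=s_1'\cdots s_n'$ over the states with $s_i'=s_i|_{(s_{i+1}\cdots s_n)(v)}$. The word problem in $HG_m$ is solvable in subexponential time $\exp(O(\log^{m-2} n))$: there are a Turing machine (with finitely many stacks, over finite alphabets) and a constant $C$, both depending only on $m$, such that the machine decides, for every word $w$ over the states of $\mathcal{H}_m$,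 whether $w$ represents the identity of $HG_m$, and makes at most $\exp(C\log^{m-2} n)$ steps on every $w$ of length $n\ge 2$. Moreover, a word $w$ over the states represents the identity of $HG_m$ if and only if every section $w|_v$, $v\in X_m^*$, acts trivially on the alphabet $X_m$. -/

import Mathlib

/-- A Mealy automaton with set of states `S` over the alphabet `X`: reading the letter `x` in the
state `s`, it outputs the letter `out s x` and passes to the state `next s x`. -/
structure MealyAutomaton (S X : Type) where
  /-- the transition function -/
  next : S → X → S
  /-- the output function -/
  out : S → X → X

namespace MealyAutomaton

variable {S X : Type} (A : MealyAutomaton S X)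

/-- The transformation of words over the alphabet defined by the initial state `s`. -/
def act : S → List X → List X
  | _, [] => []
  | s, x :: v => A.out s x :: act (A.next s x) v

/-- The section `s|_v`: the state reached from `s` after processing the word `v`. -/
def sect : S → List X → S
  | s, [] => s
  | s, x :: v => sect (A.next s x) v

/-- The (left) action of a word over states: `(s₁ s₂ … sₙ)(v) = (s₁ … sₙ₋₁)(sₙ(v))`. -/
def wordAct : List S → List X → List X
  | [], v => v
  | s :: w, v => A.act s (wordAct w v)

/-- The section of a word over states, again a word over states:
`(s₁ … sₙ)|_v = s₁' … sₙ'`, where `sᵢ' = sᵢ|_{(sᵢ₊₁ … sₙ)(v)}`. -/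
def wordSect : List S → List X → List S
  | [], _ => []
  | s :: w, v => A.sect s (A.wordAct w v) :: wordSect w v

/-- An automaton is invertible if all its states define invertible transformations. -/
def IsInvertible : Prop :=
  ∀ s, Function.Bijective (A.act s)

variable {A}

/-- The invertible transformation defined by a state of an invertible automaton. -/
noncomputable def IsInvertible.perm (h : A.IsInvertible) (s : S) : Equiv.Perm (List X) :=
  Equiv.ofBijective (A.act s) (h s)

/-- The automaton group: the group generated under composition by the transformations that the
states define. -/
def IsInvertible.group (h : A.IsInvertible) : Subgroup (Equiv.Perm (List X)) :=
  Subgroup.closure (Set.range h.perm)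

/-- The generator of the automaton group given by a state. -/
noncomputable def IsInvertible.gen (h : A.IsInvertible) (s : S) : h.group :=
  ⟨h.perm s, Subgroup.subset_closure ⟨s, rfl⟩⟩

/-- The element of the automaton group represented by a word over states. -/
noncomputable def IsInvertible.eval (h : A.IsInvertible) (w : List S) : h.group :=
  (w.map h.gen).prod

open Classical in
/-- The word problem of the automaton group: does the word `w` over states represent the
identity? -/
noncomputable def IsInvertible.wordProblem (h : A.IsInvertible) (w : List S) : Bool :=
  decide (h.eval w = 1)

end MealyAutomaton

/-- The states of the Hanoi automaton on `m` pegs: the trivial state `e`, here `none`, and one state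
`a_σ`, here `some σ`, for each transposition `σ` of the alphabet. -/
abbrev HanoiState (m : ℕ) : Type :=
  Option {σ : Equiv.Perm (Fin m) // σ.IsSwap}

/-- The Hanoi automaton. The state `a_(ij)` has arrows to `e` labeled `i|j` and `j|i`, and a loop
labeled `x|x` for every other letter `x`; the state `e` has a loop labeled `x|x` for every `x`. -/
def hanoiAutomaton (m : ℕ) : MealyAutomaton (HanoiState m) (Fin m) where
  next
    | none, _ => none
    | some σ, x => if σ.1 x = x then some σ else none
  out
    | none, x => x
    | some σ, x => σ.1 x

theorem hanoiAutomaton_act_none (m : ℕ) (v : List (Fin m)) :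
    (hanoiAutomaton m).act none v = v := by
  induction v with
  | nil => rfl
  | cons x v ih => exact congrArg (x :: ·) ih

theorem hanoiAutomaton_act_act (m : ℕ) (s : HanoiState m) (v : List (Fin m)) :
    (hanoiAutomaton m).act s ((hanoiAutomaton m).act s v) = v := by
  cases s with
  | none => rw [hanoiAutomaton_act_none, hanoiAutomaton_act_none]
  | some σ =>
    have hσ : ∀ x, σ.1 (σ.1 x) = x := by
      obtain ⟨σ, i, j, -, rfl⟩ := σ
      intro x
      simp
    induction v with
    | nil => rfl
    | cons x v ih =>
      by_cases hx : σ.1 x = x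
      · simpa [MealyAutomaton.act, hanoiAutomaton, hx] using ih
      · have hx' : ¬ x = σ.1 x := fun h => hx h.symm
        simpa [MealyAutomaton.act, hanoiAutomaton, hx, hx', hσ] using
          (congrArg _ (hanoiAutomaton_act_none m v)).trans (hanoiAutomaton_act_none m v)

/-- The Hanoi automaton is invertible, so that the Hanoi Towers group on `m` pegs is
`(hanoiAutomaton_isInvertible m).group`. -/
theorem hanoiAutomaton_isInvertible (m : ℕ) : (hanoiAutomaton m).IsInvertible :=
  fun s => (show Function.Involutive _ from hanoiAutomaton_act_act m s).bijective

/-! A word acts trivially iff all its sections fix every letter, and a section equal to the word it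
comes from brings no new condition. So it suffices to search the tree of proper sections
(`isTrivialR_iff`). A node has at most `m` children and costs time linear in `n`, hence everything
rests on the depth of this tree being `O(log^(m-2) n)`.

For the depth, read a path `v` of letters as a position of the Towers of Hanoi: the letter at index
`d` is the peg of disk `d`, smaller indices being smaller disks. Applying the states of the word one
after another is a play with at most one move per state. A section at a letter is proper exactly
when that letter is moved at some time, so along a path of proper sections every disk of `v` moves.

It remains to bound the number of disks that can all move in `2 ^ q` steps on `k` pegs
(`card_le_hanoiBound`). Halving the time interval gives `f k (q + 1) ≤ f k q + 2 * f (k - 1) q`: a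
disk at rest during one half blocks its peg for all larger disks. Hence `f k q ≤ (2 * q + 1) ^ (k -
2)` for `k ≥ 2`, with `q` about `log₂ n`.

The stack machine performs the depth-first search (`reachIn_check`), and its time `O(n) * (m + 1) ^
depth` is turned into the exponential bound by `exists_totalTime_le_exp`. -/

/-! ### A lower bound for the Towers of Hanoi with several pegs -/

/-- The disks `S` play the Towers of Hanoi on the pegs `Y` during the time interval `[a, b]`: the
disk `d` is on the peg `c i d` at the time `i`, at most one disk moves at a time, and a disk moves
only if there are no smaller disks on the two pegs involved. -/
structure IsHanoiPlay {P : Type*} (S : Finset ℕ) (Y : Finset P) (c : ℕ → ℕ → P) (a b : ℕ) :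
    Prop where
  mem : ∀ i, a ≤ i → i ≤ b → ∀ d ∈ S, c i d ∈ Y
  single : ∀ i, a ≤ i → i < b → ∀ d ∈ S, ∀ d' ∈ S, c (i + 1) d ≠ c i d → c (i + 1) d' ≠ c i d' →
    d = d'
  free : ∀ i, a ≤ i → i < b → ∀ d ∈ S, c (i + 1) d ≠ c i d → ∀ d' ∈ S, d' < d →
    c i d' ≠ c i d ∧ c i d' ≠ c (i + 1) d

/-- The disk `d` moves during the time interval `[a, b]`. -/
def Moves {P : Type*} (c : ℕ → ℕ → P) (a b d : ℕ) : Prop :=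
  ∃ i, a ≤ i ∧ i < b ∧ c (i + 1) d ≠ c i d

/-- An upper bound for the number of disks that can be moved on `k` pegs in `2 ^ q` steps. -/
def hanoiBound : ℕ → ℕ → ℕ
  | 0, _ => 0
  | 1, _ => 0
  | _ + 2, 0 => 1
  | k + 2, q + 1 => hanoiBound (k + 2) q + 2 * hanoiBound (k + 1) q

/-- The recursion is dominated because `(2q+3)^(k+1) = (2q+1)(2q+3)^k + 2(2q+3)^k`. -/
theorem hanoiBound_le (k q : ℕ) : hanoiBound (k + 2) q ≤ (2 * q + 1) ^ k := by
  induction k generalizing q with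
  | zero =>
    induction q with
    | zero => simp [hanoiBound]
    | succ q ih => simpa [hanoiBound] using ih
  | succ k ih =>
    induction q with
    | zero => simp [hanoiBound]
    | succ q ihq =>
      have h1 := ih q
      have h2 : (2 * q + 1) ^ k ≤ (2 * (q + 1) + 1) ^ k := Nat.pow_le_pow_left (by omega) _
      simp only [hanoiBound]
      rw [pow_succ] at ihq ⊢
      nlinarith

section

variable {P : Type*} {S T : Finset ℕ} {Y : Finset P} {c : ℕ → ℕ → P} {a b a' b' d : ℕ}

theorem IsHanoiPlay.mono (h : IsHanoiPlay S Y c a b) (hS : T ⊆ S) (ha : a ≤ a') (hb : b' ≤ b) :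
    IsHanoiPlay T Y c a' b' where
  mem i hi hi' d hd := h.mem i (by omega) (by omega) d (hS hd)
  single i hi hi' d hd d' hd' := h.single i (by omega) (by omega) d (hS hd) d' (hS hd')
  free i hi hi' d hd hm d' hd' := h.free i (by omega) (by omega) d (hS hd) hm d' (hS hd')

theorem eq_of_not_moves (h : ¬ Moves c a b d) (i : ℕ) (hi : a ≤ i) (hi' : i ≤ b) :
    c i d = c a d := by
  induction i, hi using Nat.le_induction with
  | base => rfl
  | succ i hi ih =>
    rw [← ih (by omega)]
    by_contra hne
    exact h ⟨i, hi, by omega, hne⟩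

/-- A disk `s` that does not move takes its peg away from the larger disks that move. -/
theorem IsHanoiPlay.erase [DecidableEq P] (h : IsHanoiPlay S Y c a b) {s : ℕ} (hs : s ∈ S)
    (hns : ¬ Moves c a b s) (hTS : T ⊆ S) (hT : ∀ d ∈ T, s < d ∧ Moves c a b d) :
    IsHanoiPlay T (Y.erase (c a s)) c a b := by
  refine { h.mono hTS le_rfl le_rfl with mem := ?_ }
  have key : ∀ d ∈ T, ∀ i, a ≤ i → i < b → c (i + 1) d ≠ c i d →
      c i d ≠ c a s ∧ c (i + 1) d ≠ c a s := by
    intro d hd i hi hi' hm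
    have := h.free i hi hi' d (hTS hd) hm s hs (hT d hd).1
    rw [eq_of_not_moves hns i hi hi'.le] at this
    exact ⟨this.1.symm, this.2.symm⟩
  intro i hi hi' d hd
  refine Finset.mem_erase.2 ⟨?_, h.mem i hi hi' d (hTS hd)⟩
  -- A disk starting on the peg of `s` could never leave it, whereas every disk of `T` moves.
  have h0 : c a d ≠ c a s := by
    intro h0
    have h1 : ∀ j, a ≤ j → j ≤ b → c j d = c a s := by
      intro j hj
      induction j, hj using Nat.le_induction with
      | base => exact fun _ => h0
      | succ j hj ih =>
        intro hj'
        by_contra hne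
        exact (key d hd j hj (by omega) fun he => hne (he.trans (ih (by omega)))).1 (ih (by omega))
    obtain ⟨j, hj, hj', hm⟩ := (hT d hd).2
    exact (key d hd j hj hj' hm).1 (h1 j hj hj'.le)
  induction i, hi using Nat.le_induction with
  | base => exact h0
  | succ j hj ih =>
    by_cases hm : c (j + 1) d = c j d
    · rw [hm]
      exact ih (by omega)
    · exact (key d hd j hj (by omega) hm).2

/-- In each half of the interval, consider the smallest disk at rest. All smaller disks move in that
half, and the larger ones that move have one peg fewer. The initial position is arbitrary, so both
halves fall under the induction hypothesis. -/
theorem card_le_hanoiBound [DecidableEq P] (k q : ℕ) :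
    ∀ (S : Finset ℕ) (Y : Finset P) (a b : ℕ), IsHanoiPlay S Y c a b → Y.card ≤ k →
      b = a + 2 ^ q → (∀ d ∈ S, Moves c a b d) → S.card ≤ hanoiBound k q := by
  classical
  induction q generalizing k with
  | zero =>
    intro S Y a b h hY hb hS
    have hmv : ∀ d ∈ S, c (a + 1) d ≠ c a d := by
      intro d hd
      obtain ⟨i, hi, hi', hm⟩ := hS d hd
      obtain rfl : i = a := by simp at hb; omega
      exact hm
    rcases S.eq_empty_or_nonempty with rfl | ⟨d, hd⟩
    · simp
    · match k with
      | 0 | 1 =>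
        exact absurd (Finset.card_le_one.1 (hY.trans (by omega)) _
          (h.mem (a + 1) (by omega) (by simp at hb; omega) d hd) _
          (h.mem a le_rfl (by omega) d hd)) (hmv d hd)
      | k + 2 =>
        exact Finset.card_le_one.2 fun d hd d' hd' =>
          h.single a le_rfl (by simp at hb; omega) d hd d' hd' (hmv d hd) (hmv d' hd')
  | succ q ih =>
    intro S Y a b h hY hb hS
    rcases S.eq_empty_or_nonempty with rfl | ⟨d₀, hd₀⟩
    · simp
    match k with
    | 0 | 1 =>
      obtain ⟨i, hi, hi', hm⟩ := hS d₀ hd₀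
      exact absurd (Finset.card_le_one.1 (hY.trans (by omega)) _
        (h.mem (i + 1) (by omega) (by omega) d₀ hd₀) _
        (h.mem i hi (by omega) d₀ hd₀)) hm
    | k + 2 =>
      obtain ⟨e, he⟩ : ∃ e, e = a + 2 ^ q := ⟨_, rfl⟩
      have hb' : b = e + 2 ^ q := by rw [hb, he]; ring
      have hpos : 0 < 2 ^ q := by positivity
      have half : ∀ a' b', a ≤ a' → b' ≤ b → b' = a' + 2 ^ q →
          S.card ≤ hanoiBound (k + 2) q ∨ ∃ s, ¬ Moves c a' b' s ∧
            (S.filter (· < s)).card ≤ hanoiBound (k + 2) q ∧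
            (S.filter fun d => s < d ∧ Moves c a' b' d).card ≤ hanoiBound (k + 1) q := by
        intro a' b' ha' hbb hab
        by_cases hall : ∀ d ∈ S, Moves c a' b' d
        · exact .inl (ih (k + 2) S Y a' b' (h.mono subset_rfl ha' hbb) hY hab hall)
        · have hne : (S.filter fun d => ¬ Moves c a' b' d).Nonempty := by
            push Not at hall
            obtain ⟨d, hd, hm⟩ := hall
            exact ⟨d, Finset.mem_filter.2 ⟨hd, hm⟩⟩
          have hs := Finset.min'_mem _ hne
          set s := (S.filter fun d => ¬ Moves c a' b' d).min' hne with hsdef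
          rw [Finset.mem_filter] at hs
          refine .inr ⟨s, hs.2, ?_, ?_⟩
          · refine ih (k + 2) _ Y a' b' (h.mono (Finset.filter_subset _ _) ha' hbb) hY hab ?_
            intro d hd
            rw [Finset.mem_filter] at hd
            by_contra hm
            exact absurd (Finset.min'_le _ d (Finset.mem_filter.2 ⟨hd.1, hm⟩)) (not_le.2 hd.2)
          · refine ih (k + 1) _ (Y.erase (c a' s)) a' b'
              ((h.mono subset_rfl ha' hbb).erase hs.1 hs.2 (Finset.filter_subset _ _) ?_) ?_ hab ?_
            · exact fun d hd => (Finset.mem_filter.1 hd).2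
            · rw [Finset.card_erase_of_mem (h.mem a' ha' (by omega) s hs.1)]
              omega
            · exact fun d hd => (Finset.mem_filter.1 hd).2.2
      have hsplit : ∀ d ∈ S, Moves c a e d ∨ Moves c e b d := by
        intro d hd
        obtain ⟨i, hi, hi', hm⟩ := hS d hd
        rcases lt_or_ge i e with hie | hie
        · exact .inl ⟨i, hi, hie, hm⟩
        · exact .inr ⟨i, hie, hi', hm⟩
      have hae : a ≤ e := by omega
      have heb : e ≤ b := by omega
      show _ ≤ hanoiBound (k + 2) q + 2 * hanoiBound (k + 1) q
      rcases half a e le_rfl heb he with h1 | ⟨s, hs, hs1, hs2⟩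
      · omega
      rcases half e b hae le_rfl hb' with h1 | ⟨t, ht, ht1, ht2⟩
      · omega
      -- With `u = max s t` the disks below `u` are counted only once, by the half that provides
      -- `u`; this is why the term with `k + 2` pegs has coefficient 1.
      obtain ⟨u, hsu, htu, hu⟩ : ∃ u, s ≤ u ∧ t ≤ u ∧
          (S.filter (· < u)).card ≤ hanoiBound (k + 2) q := by
        rcases le_total s t with hst | hst
        · exact ⟨t, hst, le_rfl, ht1⟩
        · exact ⟨s, le_rfl, hst, hs1⟩
      have hsub : S ⊆ S.filter (· < u) ∪ ((S.filter fun d => s < d ∧ Moves c a e d) ∪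
          S.filter fun d => t < d ∧ Moves c e b d) := by
        intro d hd
        simp only [Finset.mem_union, Finset.mem_filter, hd, true_and]
        rcases lt_or_ge d u with hdu | hdu
        · exact .inl hdu
        · rcases hsplit d hd with hm | hm
          -- The inequality is strict because `s` itself rests in the first half.
          · refine .inr (.inl ⟨lt_of_le_of_ne (hsu.trans hdu) ?_, hm⟩)
            rintro rfl
            exact hs hm
          · refine .inr (.inr ⟨lt_of_le_of_ne (htu.trans hdu) ?_, hm⟩)
            rintro rfl
            exact ht hm
      have := (Finset.card_le_card hsub).trans ((Finset.card_union_le _ _).trans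
        (Nat.add_le_add_left (Finset.card_union_le _ _) _))
      omega

end

/-! ### Reversed words over states

A word `s₁ ⋯ sₙ` acts from the right, so that an algorithm reads it in the order `sₙ, …, s₁`. -/

namespace MealyAutomaton

variable {S X : Type} (A : MealyAutomaton S X)

/-- The letter obtained from `x` by applying the states of a list one after another. -/
def outR : List S → X → X
  | [], x => x
  | s :: u, x => outR u (A.out s x)

/-- The list of sections at the letters met when the states of a list are applied one after
another, starting from `x`. -/
def secR : List S → X → List S
  | [], _ => []
  | s :: u, x => A.next s x :: secR u (A.out s x)

/-- The word obtained from `v` by applying the states of a list one after another. -/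
def actR : List S → List X → List X
  | [], v => v
  | s :: u, v => actR u (A.act s v)

/-- The section of a reversed word at a word. -/
def secsR : List S → List X → List S
  | u, [] => u
  | u, x :: v => secsR (A.secR u x) v

/-- All sections of the reversed word `u` act trivially on the alphabet. -/
def IsTrivialR (u : List S) : Prop :=
  ∀ v x, A.outR (A.secsR u v) x = x

/-- Every chain of proper sections at letters, starting from `u`, has length at most `d`. -/
def DepthLE : ℕ → List S → Prop
  | 0, u => ∀ x, A.secR u x = u
  | d + 1, u => ∀ x, A.secR u x ≠ u → DepthLE d (A.secR u x)

/-- Reading the word `v`, each letter properly changes the current section. -/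
def IsProperChain : List S → List X → Prop
  | _, [] => True
  | u, x :: v => A.secR u x ≠ u ∧ IsProperChain (A.secR u x) v

/-! ### Self-similarity of the action of reversed words -/

theorem secR_length (u : List S) (x : X) : (A.secR u x).length = u.length := by
  induction u generalizing x with
  | nil => rfl
  | cons s u ih => simp [secR, ih]

/-- Sections commute with prefixes, so the play of the deeper disks runs on the same clock. -/
theorem secR_take (u : List S) (x : X) (i : ℕ) :
    A.secR (u.take i) x = (A.secR u x).take i := by
  induction u generalizing x i with
  | nil => simp [secR]
  | cons s u ih => cases i <;> simp [secR, ih]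

theorem actR_append (u u' : List S) (v : List X) :
    A.actR (u ++ u') v = A.actR u' (A.actR u v) := by
  induction u generalizing v with
  | nil => rfl
  | cons s u ih => exact ih _

theorem actR_nil (u : List S) : A.actR u [] = [] := by
  induction u with
  | nil => rfl
  | cons s u ih => exact ih

theorem actR_cons (u : List S) (x : X) (v : List X) :
    A.actR u (x :: v) = A.outR u x :: A.actR (A.secR u x) v := by
  induction u generalizing x v with
  | nil => rfl
  | cons s u ih => exact ih _ _

theorem act_length (s : S) (v : List X) : (A.act s v).length = v.length := by
  induction v generalizing s with
  | nil => rfl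
  | cons x v ih => simp [act, ih]

theorem actR_length (u : List S) (v : List X) : (A.actR u v).length = v.length := by
  induction u generalizing v with
  | nil => rfl
  | cons s u ih => exact (ih _).trans (A.act_length _ _)

theorem wordAct_eq_actR (w : List S) (v : List X) : A.wordAct w v = A.actR w.reverse v := by
  induction w generalizing v with
  | nil => rfl
  | cons s w ih => rw [List.reverse_cons, actR_append, ← ih]; rfl

theorem act_append (s : S) (v v' : List X) :
    A.act s (v ++ v') = A.act s v ++ A.act (A.sect s v) v' := by
  induction v generalizing s with
  | nil => rfl
  | cons x v ih => exact congrArg (_ :: ·) (ih _)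

theorem wordAct_append (w : List S) (v v' : List X) :
    A.wordAct w (v ++ v') = A.wordAct w v ++ A.wordAct (A.wordSect w v) v' := by
  induction w with
  | nil => rfl
  | cons s w ih => simp [wordAct, wordSect, ih, act_append]

theorem wordAct_nil (w : List S) : A.wordAct w [] = [] := by
  rw [wordAct_eq_actR, actR_nil]

/-- A word acts trivially if and only if all its sections act trivially on the alphabet. -/
theorem wordAct_eq_self_iff (w : List S) :
    (∀ v, A.wordAct w v = v) ↔ ∀ v x, A.wordAct (A.wordSect w v) [x] = [x] := by
  constructor
  · intro h v x
    have h1 := A.wordAct_append w v [x]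
    rw [h, h] at h1
    exact (List.append_cancel_left h1).symm
  · intro h v
    induction v using List.reverseRecOn with
    | nil => exact A.wordAct_nil w
    | append_singleton v x ih => rw [wordAct_append, ih, h]

theorem actR_eq_self_iff (u : List S) : (∀ v, A.actR u v = v) ↔ A.IsTrivialR u := by
  -- Sections unfold at the front of `v`, while triviality is proved by adding a letter at its end;
  -- this equivalence, proved for all `u` at once, reconciles the two directions.
  have key : ∀ v u, A.actR u v = v ∧ (∀ x, A.outR (A.secsR u v) x = x) ↔
      (∀ x, A.actR u (v ++ [x]) = v ++ [x]) ∧ A.actR u v = v := by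
    intro v
    induction v with
    | nil => intro u; simp [secsR, actR_cons, actR_nil]
    | cons y v ih =>
      intro u
      simp only [secsR, List.cons_append, actR_cons, List.cons.injEq]
      have := ih (A.secR u y)
      constructor
      · rintro ⟨⟨h1, h2⟩, h3⟩
        have := this.1 ⟨h2, h3⟩
        exact ⟨fun x => ⟨h1, this.1 x⟩, h1, h2⟩
      · rintro ⟨h1, h2, h3⟩
        have := this.2 ⟨fun x => (h1 x).2, h3⟩
        exact ⟨⟨h2, h3⟩, this.2⟩
  constructor
  · exact fun h v => ((key v u).2 ⟨fun x => h _, h v⟩).2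
  · intro h v
    induction v using List.reverseRecOn with
    | nil => exact A.actR_nil u
    | append_singleton v x ih => exact ((key v u).1 ⟨ih, h v⟩).1 x

/-- Only proper sections have to be checked recursively. -/
theorem isTrivialR_iff (u : List S) : A.IsTrivialR u ↔
    (∀ x, A.outR u x = x) ∧ ∀ x, A.secR u x ≠ u → A.IsTrivialR (A.secR u x) := by
  constructor
  · exact fun h => ⟨h [], fun x _ v => h (x :: v)⟩
  · rintro ⟨h1, h2⟩ v
    induction v with
    | nil => exact h1
    | cons x v ih =>
      by_cases hx : A.secR u x = u
      · rw [secsR, hx]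
        exact ih
      · exact h2 x hx v

theorem exists_isProperChain_of_not_depthLE (d : ℕ) (u : List S) (h : ¬ A.DepthLE d u) :
    ∃ v, v.length = d + 1 ∧ A.IsProperChain u v := by
  induction d generalizing u with
  | zero =>
    simp only [DepthLE, not_forall] at h
    obtain ⟨x, hx⟩ := h
    exact ⟨[x], rfl, hx, trivial⟩
  | succ d ih =>
    simp only [DepthLE, not_forall] at h
    obtain ⟨x, hx, hd⟩ := h
    obtain ⟨v, hv, hc⟩ := ih _ hd
    exact ⟨x :: v, by simp [hv], hx, hc⟩

/-! ### From group elements to actions on words -/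

theorem IsInvertible.eval_apply {A : MealyAutomaton S X} (h : A.IsInvertible) (w : List S)
    (v : List X) : (h.eval w : Equiv.Perm (List X)) v = A.wordAct w v := by
  induction w with
  | nil => rfl
  | cons s w ih =>
    have : h.eval (s :: w) = h.gen s * h.eval w := by simp [eval]
    rw [this, Subgroup.coe_mul, Equiv.Perm.mul_apply, ih]
    rfl

theorem IsInvertible.eval_eq_one_iff {A : MealyAutomaton S X} (h : A.IsInvertible) (w : List S) :
    h.eval w = 1 ↔ ∀ v, A.wordAct w v = v := by
  rw [← Subtype.coe_inj, Equiv.ext_iff]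
  simp only [IsInvertible.eval_apply, Subgroup.coe_one, Equiv.Perm.one_apply]

theorem IsInvertible.eval_eq_one_iff_isTrivialR {A : MealyAutomaton S X} (h : A.IsInvertible)
    (w : List S) : h.eval w = 1 ↔ A.IsTrivialR w.reverse := by
  rw [h.eval_eq_one_iff, ← actR_eq_self_iff]
  simp only [wordAct_eq_actR]

end MealyAutomaton

/-! ### The depth of words over the states of the Hanoi automaton -/

section

open MealyAutomaton

variable {m : ℕ}

/-- This property of the Hanoi automaton turns proper sections into moving disks. -/
theorem hanoiAutomaton_next_ne_iff (s : HanoiState m) (x : Fin m) :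
    (hanoiAutomaton m).next s x ≠ s ↔ (hanoiAutomaton m).out s x ≠ x := by
  cases s with
  | none => simp [hanoiAutomaton]
  | some σ => by_cases h : σ.1 x = x <;> simp [hanoiAutomaton, h]

theorem hanoiAutomaton_act_cons (σ : {σ : Equiv.Perm (Fin m) // σ.IsSwap}) (x : Fin m)
    (v : List (Fin m)) : (hanoiAutomaton m).act (some σ) (x :: v) =
      if σ.1 x = x then x :: (hanoiAutomaton m).act (some σ) v else σ.1 x :: v := by
  have h1 : (hanoiAutomaton m).act (some σ) (x :: v) =
      σ.1 x :: (hanoiAutomaton m).act (if σ.1 x = x then some σ else none) v := rfl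
  rw [h1]
  split_ifs with h
  · rw [h]
  · rw [hanoiAutomaton_act_none]

/-- A state moves at most one disk. -/
theorem hanoiAutomaton_act_single (s : HanoiState m) (v : List (Fin m)) (d d' : ℕ)
    (h : ((hanoiAutomaton m).act s v)[d]? ≠ v[d]?)
    (h' : ((hanoiAutomaton m).act s v)[d']? ≠ v[d']?) : d = d' := by
  cases s with
  | none => simp [hanoiAutomaton_act_none] at h
  | some σ =>
    induction v generalizing d d' with
    | nil => simp [act] at h
    | cons x v ih =>
      rw [hanoiAutomaton_act_cons] at h h'
      split_ifs at h h' with hx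
      · cases d <;> cases d' <;> simp_all
        exact ih _ _ h h'
      · cases d <;> cases d' <;> simp_all

/-- If a state moves a disk, then there are no smaller disks on the two pegs involved. -/
theorem hanoiAutomaton_act_free (s : HanoiState m) (v : List (Fin m)) (d d' : ℕ)
    (h : ((hanoiAutomaton m).act s v)[d]? ≠ v[d]?) (hd : d' < d) :
    v[d']? ≠ v[d]? ∧ v[d']? ≠ ((hanoiAutomaton m).act s v)[d]? := by
  cases s with
  | none => simp [hanoiAutomaton_act_none] at h
  | some σ =>
    -- A moved letter `y` is not fixed by the transposition, while all smaller disks lie on fixed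
    -- pegs; so they avoid both `y` and its image.
    have moved : ∀ (v : List (Fin m)) (d : ℕ), ((hanoiAutomaton m).act (some σ) v)[d]? ≠ v[d]? →
        ∃ y, σ.1 y ≠ y ∧ v[d]? = some y ∧
          ((hanoiAutomaton m).act (some σ) v)[d]? = some (σ.1 y) := by
      intro v
      induction v with
      | nil => intro d h; simp [act] at h
      | cons x v ih =>
        intro d h
        rw [hanoiAutomaton_act_cons] at h ⊢
        split_ifs at h ⊢ with hx
        · cases d with
          | zero => simp at h
          | succ d => simpa using ih d (by simpa using h)
        · cases d with
          | zero => exact ⟨x, hx, by simp⟩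
          | succ d => simp at h
    induction v generalizing d d' with
    | nil => simp [act] at h
    | cons x v ih =>
      obtain ⟨y, hy, h1, h2⟩ := moved _ _ h
      rw [h1, h2]
      rw [hanoiAutomaton_act_cons] at h h2
      split_ifs at h h2 with hx
      · cases d with
        | zero => omega
        | succ d =>
          cases d' with
          | zero =>
            simp only [List.getElem?_cons_zero, ne_eq, Option.some.injEq]
            refine ⟨?_, ?_⟩
            · rintro rfl
              exact hy hx
            · rintro rfl
              exact hy (σ.1.injective hx)
          | succ d' =>
            have := ih d d' (by omega) (by simpa using h)
            simpa [← h1, ← h2] using this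
      · cases d with
        | zero => omega
        | succ d => simp at h

theorem exists_moved_of_secR_ne (u : List (HanoiState m)) (x : Fin m)
    (h : (hanoiAutomaton m).secR u x ≠ u) : ∃ i < u.length,
      (hanoiAutomaton m).outR (u.take (i + 1)) x ≠ (hanoiAutomaton m).outR (u.take i) x := by
  induction u generalizing x with
  | nil => exact absurd rfl h
  | cons s u ih =>
    by_cases hs : (hanoiAutomaton m).next s x = s
    · have hu : (hanoiAutomaton m).secR u ((hanoiAutomaton m).out s x) ≠ u := by
        intro hu
        exact h (by rw [secR, hs, hu])
      obtain ⟨i, hi, hm⟩ := ih _ hu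
      exact ⟨i + 1, by simpa using hi, by simpa [outR] using hm⟩
    · exact ⟨0, by simp, by simpa [outR] using (hanoiAutomaton_next_ne_iff s x).1 hs⟩

/-- The motion of disk `d` is governed by the section at the preceding `d` letters, and the chain
changes this section properly at the next letter. -/
theorem exists_moved_of_isProperChain (v : List (Fin m)) (u : List (HanoiState m))
    (h : (hanoiAutomaton m).IsProperChain u v) (d : ℕ) (hd : d < v.length) :
    ∃ i < u.length, ((hanoiAutomaton m).actR (u.take (i + 1)) v)[d]? ≠
      ((hanoiAutomaton m).actR (u.take i) v)[d]? := by
  induction v generalizing u d with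
  | nil => simp at hd
  | cons x v ih =>
    simp only [actR_cons]
    cases d with
    | zero => simpa using exists_moved_of_secR_ne u x h.1
    | succ d => simpa [secR_take, secR_length] using ih _ h.2 d (by simpa using hd)

theorem length_le_of_isProperChain (hm : 2 ≤ m) (v : List (Fin m)) (u : List (HanoiState m))
    (h : (hanoiAutomaton m).IsProperChain u v) :
    v.length ≤ (2 * Nat.clog 2 u.length + 1) ^ (m - 2) := by
  classical
  obtain ⟨k, rfl⟩ := Nat.exists_eq_add_of_le' hm
  refine le_trans ?_ (hanoiBound_le k _)
  -- The pegs are optional only because of the list lookup. Beyond the end of `u` the play stands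
  -- still, so its duration may be rounded up to a power of two.
  set c : ℕ → ℕ → Option (Fin (k + 2)) :=
    fun i d => ((hanoiAutomaton (k + 2)).actR (u.take i) v)[d]? with hc
  have hstep : ∀ i, (∀ d, c (i + 1) d = c i d) ∨ ∃ s v', ∀ d, c i d = v'[d]? ∧
      c (i + 1) d = ((hanoiAutomaton (k + 2)).act s v')[d]? := by
    intro i
    rcases lt_or_ge i u.length with hi | hi
    · refine .inr ⟨u[i], (hanoiAutomaton (k + 2)).actR (u.take i) v, fun d => ⟨rfl, ?_⟩⟩
      simp only [hc]
      rw [List.take_add_one, actR_append]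
      simp [hi, actR]
    · refine .inl fun d => ?_
      simp only [hc]
      rw [List.take_of_length_le hi, List.take_of_length_le (by omega)]
  have hplay : IsHanoiPlay (Finset.range v.length)
      ((Finset.univ : Finset (Fin (k + 2))).image some) c 0 (0 + 2 ^ Nat.clog 2 u.length) := by
    refine ⟨?_, ?_, ?_⟩
    · intro i _ _ d hd
      have : d < ((hanoiAutomaton (k + 2)).actR (u.take i) v).length := by
        simpa [actR_length] using hd
      simp [hc, List.getElem?_eq_getElem this]
    · intro i _ _ d _ d' _ h1 h2
      rcases hstep i with h | ⟨s, v', h⟩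
      · exact absurd (h d) h1
      · simp only [h] at h1 h2
        exact hanoiAutomaton_act_single s v' d d' h1 h2
    · intro i _ _ d _ h1 d' _ hd'
      rcases hstep i with h | ⟨s, v', h⟩
      · exact absurd (h d) h1
      · simp only [h] at h1 ⊢
        exact hanoiAutomaton_act_free s v' d d' h1 hd'
  have := card_le_hanoiBound (k + 2) _ _ _ _ _ hplay
    (by rw [Finset.card_image_of_injective _ (Option.some_injective _)]; simp) rfl
  rw [Finset.card_range] at this
  refine this fun d hd => ?_
  obtain ⟨i, hi, hmv⟩ := exists_moved_of_isProperChain v u h d (Finset.mem_range.1 hd)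
  exact ⟨i, by omega, by have := Nat.le_pow_clog one_lt_two u.length; omega, hmv⟩

theorem hanoiAutomaton_depthLE (hm : 2 ≤ m) (u : List (HanoiState m)) :
    (hanoiAutomaton m).DepthLE ((2 * Nat.clog 2 u.length + 1) ^ (m - 2)) u := by
  by_contra h
  obtain ⟨v, hv, hc⟩ := exists_isProperChain_of_not_depthLE _ _ _ h
  have := length_le_of_isProperChain hm v u hc
  omega

end

/-! ### A machine checking recursively all proper sections of a word -/

namespace SectionMachine

open Turing MealyAutomaton Function

/-- The stacks: the input, the output, the list of the words that remain to be checked, and the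
sections of the current word at the letters. -/
inductive Stack (m : ℕ) : Type
  | input
  | output
  | work
  | aux (x : Fin m)
  deriving DecidableEq, Fintype

/-- The stack alphabets; on the work stack each word is terminated by `none`. -/
abbrev Symb (S : Type) {m : ℕ} : Stack m → Type
  | .input => S
  | .output => Bool
  | .work => Option S
  | .aux _ => Option S

/-- The labels of the program. -/
inductive Label (m : ℕ) : Type
  | start
  | load
  | run
  | enter (i : Fin (m + 1))
  | collect (x : Fin m)
  deriving Fintype

/-- The registers: the symbol read last, the map on the letters defined by the part of the current
word read so far, whether the sections of this part are proper, and whether a nontrivial action on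
a letter was found. -/
structure Reg (S : Type) (m : ℕ) : Type where
  buf : Option (Option S)
  map : Fin m → Fin m
  changed : Fin m → Bool
  bad : Bool

noncomputable instance (S : Type) (m : ℕ) [Finite S] : Fintype (Reg S m) := by
  have : Injective fun r : Reg S m => (r.buf, r.map, r.changed, r.bad) := by
    rintro ⟨⟩ ⟨⟩ h
    simpa using h
  have := Finite.of_injective _ this
  exact Fintype.ofFinite _

variable {S : Type} {m : ℕ}

/-- The registers before a word is read. -/
def Reg.ready (S : Type) (m : ℕ) (b : Bool) : Reg S m where
  buf := none
  map := id
  changed _ := false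
  bad := b

/-- The statements of the program. -/
abbrev Stmt (S : Type) (m : ℕ) : Type := TM2.Stmt (Symb S (m := m)) (Label m) (Reg S m)

/-- The configurations of the machine. -/
abbrev Cfg (S : Type) (m : ℕ) : Type := TM2.Cfg (Symb S (m := m)) (Label m) (Reg S m)

/-- The contents of the stacks. -/
def stk (i : List S) (o : List Bool) (w : List (Option S)) (a : Fin m → List (Option S)) :
    ∀ k : Stack m, List (Symb S k)
  | .input => i
  | .output => o
  | .work => w
  | .aux x => a x

section

variable (i : List S) (o : List Bool) (w : List (Option S)) (a : Fin m → List (Option S))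

@[simp] theorem stk_input : stk i o w a .input = i := rfl

@[simp] theorem stk_output : stk i o w a .output = o := rfl

@[simp] theorem stk_work : stk i o w a .work = w := rfl

@[simp] theorem stk_aux (x : Fin m) : stk i o w a (.aux x) = a x := rfl

@[simp] theorem update_stk_input (i' : List S) :
    update (stk i o w a) .input i' = stk i' o w a := by
  funext k; cases k <;> simp [update]

@[simp] theorem update_stk_output (o' : List Bool) :
    update (stk i o w a) .output o' = stk i o' w a := by
  funext k; cases k <;> simp [update]

@[simp] theorem update_stk_work (w' : List (Option S)) :
    update (stk i o w a) .work w' = stk i o w' a := by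
  funext k; cases k <;> simp [update]

@[simp] theorem update_stk_aux (x : Fin m) (l : List (Option S)) :
    update (stk i o w a) (.aux x) l = stk i o w (update a x l) := by
  funext k
  cases k with
  | aux y => by_cases h : y = x <;> simp [update, h]; subst h; simp
  | _ => simp [update]

end

/-- The representation of a list of words on the work stack. -/
def encodeWords (L : List (List S)) : List (Option S) :=
  L.flatMap fun u => u.map some ++ [none]

theorem encodeWords_cons (u : List S) (L : List (List S)) :
    encodeWords (u :: L) = u.map some ++ none :: encodeWords L := by
  simp [encodeWords]

theorem encodeWords_append (L L' : List (List S)) :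
    encodeWords (L ++ L') = encodeWords L ++ encodeWords L' := by
  simp [encodeWords]

variable (A : MealyAutomaton S (Fin m))

/-- Push the sections of the state read last on the auxiliary stacks. -/
def pushSections (q : Stmt S m) : List (Fin m) → Stmt S m
  | [] => q
  | x :: l => .push (.aux x) (fun r => r.buf.join.map fun s => A.next s (r.map x))
      (pushSections q l)

theorem stepAux_pushSections (q : Stmt S m) (r : Reg S m) (i : List S) (o : List Bool)
    (w : List (Option S)) (a : Fin m → List (Option S)) (l : List (Fin m)) (hl : l.Nodup) :
    TM2.stepAux (pushSections A q l) r (stk i o w a) = TM2.stepAux q r (stk i o w fun x =>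
      if x ∈ l then (r.buf.join.map fun s => A.next s (r.map x)) :: a x else a x) := by
  induction l generalizing a with
  | nil => simp [pushSections]
  | cons y l ih =>
    rw [List.nodup_cons] at hl
    simp only [pushSections, TM2.stepAux, update_stk_aux, stk_aux, ih _ hl.2]
    congr 2
    funext x
    by_cases hx : x = y
    · subst hx; simp [hl.1]
    · simp [hx]

variable [DecidableEq S]

/-- The registers after the state `s` is read. -/
def Reg.read (r : Reg S m) (s : S) : Reg S m where
  buf := none
  map x := A.out s (r.map x)
  changed x := r.changed x || !decide (A.next s (r.map x) = s)
  bad := r.bad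

/-- Clear the symbol read last. -/
def Reg.clear (r : Reg S m) : Reg S m := { r with buf := none }

/-- Compare the map with the identity. -/
def Reg.check (r : Reg S m) : Reg S m :=
  { r with buf := none, bad := r.bad || decide (∃ x, r.map x ≠ x) }

/-- The section at `x` has to be checked. -/
def Reg.keep (r : Reg S m) (x : Fin m) : Bool := r.changed x && !r.bad

/-- The program of the machine. -/
def program : Label m → Stmt S m
  | .start => .push .work (fun _ => none) (.goto fun _ => .load)
  | .load =>
    .pop .input (fun r o => { r with buf := o.map some }) <|
    .branch (fun r => r.buf.isSome)
      (.push .work (fun r => r.buf.join) <| .load Reg.clear <| .goto fun _ => .load)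
      (.load Reg.clear <| .goto fun _ => .run)
  | .run =>
    .pop .work (fun r o => { r with buf := o }) <|
    .branch (fun r => r.buf.isSome)
      (.branch (fun r => r.buf.join.isSome)
        (pushSections A
          (.load (fun r => (r.buf.join.map (r.read A)).getD r) <| .goto fun _ => .run)
          (List.finRange m))
        (.load Reg.check <| .goto fun _ => .enter 0))
      (.push .output (fun r => !r.bad) <| .load (fun _ => .ready S m false) .halt)
  | .enter i =>
    if h : i.1 < m then
      .branch (fun r => r.keep ⟨i, h⟩)
        (.push .work (fun _ => none) <| .goto fun _ => .collect ⟨i, h⟩)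
        (.goto fun _ => .collect ⟨i, h⟩)
    else .load (fun r => .ready S m r.bad) <| .goto fun _ => .run
  | .collect x =>
    .pop (.aux x) (fun r o => { r with buf := o }) <|
    .branch (fun r => r.buf.isSome)
      (.branch (fun r => r.keep x)
        (.push .work (fun r => r.buf.join) <| .load Reg.clear <| .goto fun _ => .collect x)
        (.load Reg.clear <| .goto fun _ => .collect x))
      (.load Reg.clear <| .goto fun _ => .enter x.succ)

/-- The configuration `c'` is reached from `c` in at most `n` steps. -/
def ReachIn (c c' : Cfg S m) (n : ℕ) : Prop :=
  ∃ k ≤ n, (flip bind (TM2.step (program A)))^[k] (some c) = some c'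

section

variable {A} {c c' c'' : Cfg S m} {n n' : ℕ}

theorem ReachIn.refl (c : Cfg S m) (n : ℕ) : ReachIn A c c n := ⟨0, by omega, rfl⟩

theorem ReachIn.trans (h : ReachIn A c c' n) (h' : ReachIn A c' c'' n') :
    ReachIn A c c'' (n + n') := by
  obtain ⟨k, hk, e⟩ := h
  obtain ⟨k', hk', e'⟩ := h'
  exact ⟨k' + k, by omega, by rw [iterate_add_apply, e, e']⟩

theorem ReachIn.mono (h : ReachIn A c c' n) (hn : n ≤ n') : ReachIn A c c' n' := by
  obtain ⟨k, hk, e⟩ := h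
  exact ⟨k, by omega, e⟩

theorem ReachIn.head (h : TM2.step (program A) c = some c') (h' : ReachIn A c' c'' n) :
    ReachIn A c c'' (n + 1) := by
  obtain ⟨k, hk, e⟩ := h'
  refine ⟨k + 1, by omega, ?_⟩
  rw [iterate_succ_apply]
  change (flip bind (TM2.step (program A)))^[k] (TM2.step (program A) c) = _
  rw [h, e]

end

/-! ### Phases of a run -/

theorem reachIn_load (l : List S) (r : Reg S m) (w : List (Option S)) (hr : r.buf = none) :
    ReachIn A ⟨some .load, r, stk l [] w fun _ => []⟩
      ⟨some .run, r, stk [] [] (l.reverse.map some ++ w) fun _ => []⟩ (l.length + 1) := by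
  have hc : r = { r with buf := none } := by cases r; simp_all
  induction l generalizing w with
  | nil =>
    refine .head ?_ (.refl _ _)
    simp [program, Reg.clear, ← hc, hr]
  | cons s l ih =>
    refine .head (c' := ⟨some .load, r, stk l [] (some s :: w) fun _ => []⟩) ?_ ?_
    · simp [program, Reg.clear, ← hc]
    · simpa using ih (some s :: w)

/-- The registers after a list of states is read. -/
def Reg.readList (r : Reg S m) (u : List S) : Reg S m where
  buf := none
  map x := A.outR u (r.map x)
  changed x := r.changed x || !decide (A.secR u (r.map x) = u)
  bad := r.bad

/-- One pass yields the sections at all letters, since `map` records where each letter has been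
carried. Stacking reverses them; the collecting phase restores the order. -/
theorem reachIn_run (u : List S) (r : Reg S m) (w : List (Option S))
    (a : Fin m → List (Option S)) (hr : r.buf = none) :
    ReachIn A ⟨some .run, r, stk [] [] (u.map some ++ w) a⟩
      ⟨some .run, r.readList A u, stk [] [] w
        fun x => (A.secR u (r.map x)).reverse.map some ++ a x⟩ u.length := by
  induction u generalizing r a with
  | nil =>
    have : r.readList A [] = r := by cases r; simp_all [Reg.readList, outR, secR]
    simpa [secR, this] using ReachIn.refl _ _
  | cons s u ih =>
    refine .head (c' := ⟨some .run, r.read A s, stk [] [] (u.map some ++ w)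
      fun x => some (A.next s (r.map x)) :: a x⟩) ?_ ?_
    · simp [program, stepAux_pushSections _ _ _ _ _ _ _ _ (List.nodup_finRange m), Reg.read]
    · have h : (r.read A s).readList A u = r.readList A (s :: u) := by
        simp only [Reg.readList, Reg.read, outR, secR, Reg.mk.injEq, true_and, and_true]
        funext x
        rw [Bool.eq_iff_iff]
        by_cases h : A.next s (r.map x) = s
        · simp only [h, decide_true, Bool.not_true, Bool.or_false, Bool.or_eq_true,
            Bool.not_eq_true', List.cons.injEq, true_and]
          exact or_congr_right (decide_eq_false_iff_not.trans decide_eq_false_iff_not.symm)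
        · simp [h]
      have := ih (r.read A s) (fun x => some (A.next s (r.map x)) :: a x) rfl
      rw [h] at this
      simpa [Reg.read, secR] using this

theorem reachIn_collect (x : Fin m) (r : Reg S m) (w : List (Option S))
    (a : Fin m → List (Option S)) (hr : r.buf = none) (l : List S) (hl : a x = l.map some) :
    ReachIn A ⟨some (.collect x), r, stk [] [] w a⟩
      ⟨some (.enter x.succ), r, stk [] []
        (if r.keep x then l.reverse.map some ++ w else w) (update a x [])⟩ (l.length + 1) := by
  have hc : r = { r with buf := none } := by cases r; simp_all
  induction l generalizing w a with
  | nil =>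
    refine .head ?_ (.refl _ _)
    have : update a x [] = a := (congrArg (update a x) hl).symm.trans (update_eq_self x a)
    simp [program, Reg.clear, ← hc, hr, hl, this]
  | cons s l ih =>
    refine .head (c' := ⟨some (.collect x), r, stk [] []
      (if r.keep x then some s :: w else w) (update a x (l.map some))⟩) ?_ ?_
    · have hk : ∀ b : Option (Option S), Reg.keep { r with buf := b } x = r.keep x := fun _ => rfl
      cases h : r.keep x <;> simp [program, Reg.clear, ← hc, hl, hk, h]
    · have := ih (if r.keep x then some s :: w else w) (update a x (l.map some)) (by simp)
      cases h : r.keep x <;> simpa [h] using this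

/-- Induction on the number `n` of letters left, the auxiliary stacks below `j` being already empty.
Once `bad` is set nothing more is kept, so that the work stack is merely drained; completeness of
`L` is therefore claimed only for `r.bad = false`. -/
theorem reachIn_enter (u : List S) (r : Reg S m) (hr : r.buf = none)
    (hch : ∀ x, r.changed x = !decide (A.secR u x = u)) (n j : ℕ) (hj : j + n = m)
    (w : List (Option S)) :
    ∃ L : List (List S), L.length ≤ n ∧ (∀ u' ∈ L, ∃ x, A.secR u x ≠ u ∧ u' = A.secR u x) ∧
      (r.bad = false → ∀ x : Fin m, j ≤ x → A.secR u x ≠ u → A.secR u x ∈ L) ∧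
      ReachIn A ⟨some (.enter ⟨j, by omega⟩), r, stk [] [] w
          fun x => if x.1 < j then [] else (A.secR u x).reverse.map some⟩
        ⟨some .run, .ready S m r.bad, stk [] [] (encodeWords L ++ w) fun _ => []⟩
        (n * (u.length + 2) + 1) := by
  induction n generalizing j w with
  | zero =>
    refine ⟨[], le_rfl, by simp, fun _ x hx => by omega, ?_⟩
    refine .head ?_ (.refl _ _)
    obtain rfl : j = m := hj
    simp [program, encodeWords]
  | succ n ih =>
    have hjm : j < m := by omega
    obtain ⟨L, hL1, hL2, hL3, hL⟩ := ih (j + 1) (by omega)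
      (if r.keep ⟨j, hjm⟩ then encodeWords [A.secR u ⟨j, hjm⟩] ++ w else w)
    -- The section at `j` is pushed before those at later letters, hence lies below them.
    refine ⟨L ++ if r.keep ⟨j, hjm⟩ then [A.secR u ⟨j, hjm⟩] else [], ?_, ?_, ?_, ?_⟩
    · split_ifs <;> simp <;> omega
    · intro u' hu'
      rcases List.mem_append.1 hu' with h | h
      · exact hL2 u' h
      · split_ifs at h with hk
        · simp only [Reg.keep, hch, Bool.and_eq_true, Bool.not_eq_true',
            decide_eq_false_iff_not] at hk
          exact ⟨⟨j, hjm⟩, hk.1, by simpa using h⟩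
        · simp at h
    · intro hb x hx hne
      rcases hx.eq_or_lt with rfl | hx
      · simp [Reg.keep, hb, hch, hne]
      · exact List.mem_append_left _ (hL3 hb x hx hne)
    · have h1 := reachIn_collect A ⟨j, hjm⟩ r
        (if r.keep ⟨j, hjm⟩ then none :: w else w)
        (fun x => if x.1 < j then [] else (A.secR u x).reverse.map some) hr
        (A.secR u ⟨j, hjm⟩).reverse (by simp)
      have h2 : update (fun x : Fin m => if x.1 < j then [] else
          (A.secR u x).reverse.map some) ⟨j, hjm⟩ [] =
          fun x => if x.1 < j + 1 then [] else (A.secR u x).reverse.map some := by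
        funext x
        by_cases hx : x = ⟨j, hjm⟩
        · simp [hx]
        · have : x.1 ≠ j := fun h => hx (Fin.ext h)
          rw [update_of_ne hx]
          congr 1
          simp only [eq_iff_iff]
          omega
      rw [h2] at h1
      have h3 : TM2.step (program A) ⟨some (.enter ⟨j, by omega⟩), r, stk [] [] w
          fun x => if x.1 < j then [] else (A.secR u x).reverse.map some⟩ =
          some ⟨some (.collect ⟨j, hjm⟩), r, stk [] [] (if r.keep ⟨j, hjm⟩ then none :: w else w)
            fun x => if x.1 < j then [] else (A.secR u x).reverse.map some⟩ := by
        cases h : r.keep ⟨j, hjm⟩ <;> simp [program, hjm, h]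
      have h4 := (ReachIn.head h3 h1)
      have h5 : (if r.keep ⟨j, hjm⟩ then (A.secR u ⟨j, hjm⟩).reverse.reverse.map some ++
            (if r.keep ⟨j, hjm⟩ then none :: w else w)
          else (if r.keep ⟨j, hjm⟩ then none :: w else w)) =
          if r.keep ⟨j, hjm⟩ then encodeWords [A.secR u ⟨j, hjm⟩] ++ w else w := by
        split_ifs <;> simp [encodeWords]
      rw [h5] at h4
      have h6 := h4.trans hL
      have h7 : encodeWords L ++ (if r.keep ⟨j, hjm⟩ then
            encodeWords [A.secR u ⟨j, hjm⟩] ++ w else w) =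
          encodeWords (L ++ if r.keep ⟨j, hjm⟩ then [A.secR u ⟨j, hjm⟩] else []) ++ w := by
        rw [encodeWords_append]
        split_ifs <;> simp [encodeWords]
      rw [h7] at h6
      refine h6.mono ?_
      rw [List.length_reverse, secR_length]
      ring_nf
      omega

/-! ### Depth-first search in the tree of proper sections -/

/-- The configuration in which the words of the list `L` remain to be checked. -/
def pending (b : Bool) (L : List (List S)) : Cfg S m :=
  ⟨some .run, .ready S m b, stk [] [] (encodeWords L) fun _ => []⟩

/-- An upper bound for the time needed to replace a word of length `n` by its proper sections. -/
def expandTime (m n : ℕ) : ℕ := n + 1 + (m * (n + 2) + 1)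

/-- The machine replaces a word by its proper sections at letters. -/
theorem reachIn_expand (u : List S) (b : Bool) (W : List (List S)) :
    ∃ (b' : Bool) (L : List (List S)), (b' = true ↔ b = true ∨ ∃ x, A.outR u x ≠ x) ∧
      L.length ≤ m ∧ (∀ u' ∈ L, ∃ x, A.secR u x ≠ u ∧ u' = A.secR u x) ∧
      (b' = false → ∀ x : Fin m, A.secR u x ≠ u → A.secR u x ∈ L) ∧
      ReachIn A (pending b (u :: W)) (pending b' (L ++ W)) (expandTime m u.length) := by
  obtain ⟨r, hr⟩ : ∃ r, r = ((Reg.ready S m b).readList A u).check := ⟨_, rfl⟩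
  obtain ⟨L, hL1, hL2, hL3, hL⟩ := reachIn_enter A u r (by rw [hr]; rfl)
    (fun x => by rw [hr]; exact Bool.false_or _) m 0 (by omega) (encodeWords W)
  refine ⟨r.bad, L, ?_, hL1, hL2, fun hb x => hL3 hb x (by omega), ?_⟩
  · simp [hr, Reg.check, Reg.readList, Reg.ready]
  · have h1 := reachIn_run A u (.ready S m b) (none :: encodeWords W) (fun _ => []) rfl
    have h2 : TM2.step (program A) ⟨some .run, (Reg.ready S m b).readList A u,
        stk [] [] (none :: encodeWords W) fun x => (A.secR u x).reverse.map some ++ []⟩ =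
        some ⟨some (.enter ⟨0, by omega⟩), r, stk [] [] (encodeWords W)
          fun x => if x.1 < 0 then [] else (A.secR u x).reverse.map some⟩ := by
      simp [program, hr, Reg.check]
    have h3 := h1.trans (ReachIn.head h2 hL)
    rw [← encodeWords_cons, ← encodeWords_append] at h3
    exact h3.mono (by rw [expandTime]; omega)

/-- An upper bound for the time needed to check a word of length `n` and depth `d`. -/
def checkTime (m n : ℕ) : ℕ → ℕ
  | 0 => expandTime m n
  | d + 1 => expandTime m n + m * checkTime m n d

theorem checkTime_le (m n d : ℕ) : checkTime m n d ≤ expandTime m n * (m + 1) ^ d := by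
  induction d with
  | zero => simp [checkTime]
  | succ d ih =>
    have h1 : expandTime m n * 1 ≤ expandTime m n * (m + 1) ^ d :=
      Nat.mul_le_mul_left _ (Nat.one_le_pow _ _ (by omega))
    have h2 := Nat.mul_le_mul_left m ih
    calc checkTime m n (d + 1) = expandTime m n + m * checkTime m n d := rfl
      _ ≤ expandTime m n * (m + 1) ^ d + m * (expandTime m n * (m + 1) ^ d) := by omega
      _ = expandTime m n * (m + 1) ^ (d + 1) := by ring

theorem reachIn_list (t : ℕ) (L : List (List S)) (W : List (List S))
    (h : ∀ u ∈ L, ∀ (b : Bool) (W : List (List S)),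
      ∃ b' : Bool, (b' = true ↔ b = true ∨ ¬ A.IsTrivialR u) ∧
        ReachIn A (pending b (u :: W)) (pending b' W) t) (b : Bool) :
    ∃ b' : Bool, (b' = true ↔ b = true ∨ ∃ u ∈ L, ¬ A.IsTrivialR u) ∧
      ReachIn A (pending b (L ++ W)) (pending b' W) (L.length * t) := by
  induction L generalizing b with
  | nil => exact ⟨b, by simp, .refl _ _⟩
  | cons u L ih =>
    obtain ⟨b₁, hb₁, h₁⟩ := h u (by simp) b (L ++ W)
    obtain ⟨b₂, hb₂, h₂⟩ := ih (fun u hu => h u (by simp [hu])) b₁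
    refine ⟨b₂, ?_, (h₁.trans h₂).mono (by simp; ring_nf; omega)⟩
    rw [hb₂, hb₁]
    simp [or_assoc]

/-- The machine checks a word recursively. -/
theorem reachIn_check (n d : ℕ) (u : List S) (hd : A.DepthLE d u) (hn : u.length = n) (b : Bool)
    (W : List (List S)) : ∃ b' : Bool, (b' = true ↔ b = true ∨ ¬ A.IsTrivialR u) ∧
      ReachIn A (pending b (u :: W)) (pending b' W) (checkTime m n d) := by
  induction d generalizing u b W with
  | zero =>
    obtain ⟨b', L, hb', -, hL, -, h⟩ := reachIn_expand A u b W
    have : L = [] := by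
      refine List.eq_nil_iff_forall_not_mem.2 fun u' hu' => ?_
      obtain ⟨x, hx, -⟩ := hL u' hu'
      exact hx (hd x)
    subst this
    refine ⟨b', ?_, by simpa [hn, checkTime] using h⟩
    rw [hb', isTrivialR_iff]
    have : ∀ x, A.secR u x = u := hd
    simp [this]
  | succ d ih =>
    obtain ⟨b', L, hb', hLm, hL, hL', h⟩ := reachIn_expand A u b W
    obtain ⟨b'', hb'', h'⟩ := reachIn_list A (checkTime m n d) L W (fun u' hu' b W => by
      obtain ⟨x, hx, rfl⟩ := hL u' hu'
      exact ih _ (hd x hx) (by rw [secR_length, hn]) b W) b'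
    refine ⟨b'', ?_, (h.trans h').mono ?_⟩
    · rw [hb'', isTrivialR_iff, not_and_or]
      constructor
      · rintro (h1 | ⟨u', hu', h1⟩)
        · rcases hb'.1 h1 with h2 | h2
          · exact .inl h2
          · exact .inr (.inl (not_forall.2 h2))
        · obtain ⟨x, hx, rfl⟩ := hL u' hu'
          exact .inr (.inr fun h2 => h1 (h2 x hx))
      · intro h1
        -- If the flag is already set the answer is settled; otherwise every proper section has been
        -- queued.
        cases hbb : b' with
        | true => exact .inl rfl
        | false =>
          have h2 : ¬ (b = true ∨ ∃ x, A.outR u x ≠ x) := by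
            rw [← hb', hbb]
            simp
          rcases h1 with h1 | h1 | h1
          · exact absurd (.inl h1) h2
          · exact absurd (.inr (not_forall.1 h1)) h2
          · push Not at h1
            obtain ⟨x, hx, h1⟩ := h1
            exact .inr ⟨_, hL' hbb x hx, h1⟩
    · rw [checkTime, hn]
      exact Nat.add_le_add_left (Nat.mul_le_mul_right _ hLm) _

/-- An upper bound for the running time on words of length `n` and depth at most `d`. -/
def totalTime (m n d : ℕ) : ℕ := 1 + (n + 1) + checkTime m n d + 1

/-- Halting requires the initial registers and all stacks but the output empty, which is why even a
failed check empties the work stack. -/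
theorem reachIn_output (w : List S) (d : ℕ) (hd : A.DepthLE d w.reverse) (b : Bool)
    (hb : b = true ↔ A.IsTrivialR w.reverse) :
    ReachIn A ⟨some .start, .ready S m false, stk w [] [] fun _ => []⟩
      ⟨none, .ready S m false, stk [] [b] [] fun _ => []⟩ (totalTime m w.length d) := by
  obtain ⟨b', hb', h⟩ := reachIn_check A w.length d w.reverse hd (by simp) false []
  have h1 : TM2.step (program A) ⟨some .start, .ready S m false, stk w [] [] fun _ => []⟩ =
      some ⟨some .load, .ready S m false, stk w [] [none] fun _ => []⟩ := by simp [program]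
  have h2 := reachIn_load A w (.ready S m false) [none] rfl
  have h3 : TM2.step (program A) (pending b' []) =
      some ⟨none, .ready S m false, stk [] [b] [] fun _ => []⟩ := by
    have : b = !b' := by
      rw [Bool.eq_iff_iff, hb, Bool.not_eq_true', ← Bool.not_eq_true, hb']
      simp
    simp [program, pending, encodeWords, this, Reg.ready]
  have h4 : (w.reverse.map some ++ [none] : List (Option S)) = encodeWords [w.reverse] := by
    simp [encodeWords]
  rw [h4] at h2
  refine (ReachIn.head h1 (h2.trans (h.trans (ReachIn.head h3 (.refl _ 0))))).mono ?_
  rw [totalTime]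
  omega

/-- The machine as a bundled machine. -/
noncomputable def machine [Fintype S] : FinTM2 where
  K := Stack m
  k₀ := .input
  k₁ := .output
  Γ := Symb S
  Λ := Label m
  main := .start
  σ := Reg S m
  initialState := .ready S m false
  Γk₀Fin := inferInstanceAs (Fintype S)
  m := program A

theorem initList_machine [Fintype S] (w : List S) :
    initList (machine A) w =
      (⟨some .start, .ready S m false, stk w [] [] fun _ => []⟩ : Cfg S m) := by
  simp only [initList, machine]
  congr 1
  funext k
  cases k <;> rfl

theorem haltList_machine [Fintype S] (b : List Bool) :
    haltList (machine A) b = (⟨none, .ready S m false, stk [] b [] fun _ => []⟩ : Cfg S m) := by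
  simp only [haltList, machine]
  congr 1
  funext k
  cases k <;> rfl

theorem machine_evals [Fintype S] (h : A.IsInvertible) (D : ℕ → ℕ)
    (hD : ∀ w : List S, A.DepthLE (D w.length) w) (w : List S) :
    ∃ k ≤ totalTime m w.length (D w.length), (flip bind (machine A).step)^[k]
      (some (initList (machine A) w)) = some (haltList (machine A) [h.wordProblem w]) := by
  obtain ⟨k, hk, e⟩ := reachIn_output A w (D w.length) (by simpa using hD w.reverse)
    (h.wordProblem w)
    (by rw [← h.eval_eq_one_iff_isTrivialR]; simp [IsInvertible.wordProblem])
  rw [← initList_machine, ← haltList_machine] at e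
  exact ⟨k, hk, e⟩

/-- The word problem is decided in time bounded in terms of the depth. -/
noncomputable def computableInTime [Fintype S] (h : A.IsInvertible) (D : ℕ → ℕ)
    (hD : ∀ w : List S, A.DepthLE (D w.length) w) :
    TM2ComputableInTime (id : List S → List S) Computability.encodeBool h.wordProblem where
  tm := machine A
  inputAlphabet := Equiv.refl S
  outputAlphabet := Equiv.refl Bool
  time n := totalTime m n (D n)
  outputsFun w :=
    ⟨⟨(machine_evals A h D hD w).choose, 
      (congrArg (fun l : List S => (flip bind (machine A).step)^[_]
        (some (initList (machine A) l))) (List.map_id w)).trans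
          (machine_evals A h D hD w).choose_spec.2⟩,
      (machine_evals A h D hD w).choose_spec.1⟩

end SectionMachine

/-! ### The word problem in the Hanoi Towers groups -/

section

open SectionMachine

theorem totalTime_le (m n d : ℕ) :
    totalTime m n d ≤ (2 * m + 3) * (n + 3) * (m + 1) ^ d := by
  have h1 := checkTime_le m n d
  have h2 : 1 ≤ (m + 1) ^ d := Nat.one_le_pow _ _ (by omega)
  have h3 : n + 3 ≤ (n + 3) * (m + 1) ^ d := Nat.le_mul_of_pos_right _ h2
  have h4 : expandTime m n ≤ (2 * m + 2) * (n + 3) := by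
    rw [expandTime]
    nlinarith
  have h5 := Nat.mul_le_mul_right ((m + 1) ^ d) h4
  rw [totalTime]
  nlinarith

theorem two_mul_clog_add_one_le (n : ℕ) (hn : 2 ≤ n) :
    2 * (Nat.clog 2 n : ℝ) + 1 ≤ 8 * Real.log n := by
  have h1 : 2 ^ (Nat.clog 2 n - 1) < n :=
    Nat.pow_pred_clog_lt_self one_lt_two hn
  have hc : 0 < Nat.clog 2 n := Nat.clog_pos one_lt_two hn
  obtain ⟨q, hq⟩ : ∃ q, Nat.clog 2 n = q + 1 := ⟨_, (Nat.sub_add_cancel hc).symm⟩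
  rw [hq] at h1 ⊢
  have h2 : ((2 : ℝ) ^ q) ≤ n := by exact_mod_cast h1.le
  have h3 := Real.log_le_log (by positivity) h2
  rw [Real.log_pow] at h3
  have h4 : Real.log 2 ≤ Real.log n := Real.log_le_log (by norm_num) (by exact_mod_cast hn)
  have h5 := Real.log_two_gt_d9
  have h6 : (q : ℝ) * 0.69 ≤ q * Real.log 2 := by gcongr; linarith
  push_cast
  linarith

/-- The running time is subexponential if the depth is polylogarithmic. -/
theorem exists_totalTime_le_exp (m k : ℕ) (hk : 1 ≤ k) : ∃ C : ℝ, ∀ n : ℕ, 2 ≤ n →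
    (totalTime m n ((2 * Nat.clog 2 n + 1) ^ k) : ℝ) ≤ Real.exp (C * Real.log n ^ k) := by
  obtain ⟨l, rfl⟩ := Nat.exists_eq_add_of_le' hk
  set a := Real.log 2 with ha
  have ha0 : 0 < a := Real.log_pos (by norm_num)
  -- The three summands absorb the factors `2m + 3`, `n + 3` and `(m + 1) ^ D`. The powers of `a =
  -- log 2` occur because `log n ≥ a`.
  refine ⟨Real.log (2 * m + 3) / a ^ (l + 1) + 3 / a ^ l + Real.log (m + 1) * 8 ^ (l + 1), ?_⟩
  intro n hn
  have hn' : (2 : ℝ) ≤ n := by exact_mod_cast hn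
  set L := Real.log n with hL
  have haL : a ≤ L := Real.log_le_log (by norm_num) hn'
  have hL0 : 0 < L := ha0.trans_le haL
  set D := (2 * Nat.clog 2 n + 1) ^ (l + 1) with hD
  have hm : (0 : ℝ) ≤ m := Nat.cast_nonneg m
  have h1 : (totalTime m n D : ℝ) ≤ (2 * m + 3) * (n + 3) * (m + 1) ^ D := by
    exact_mod_cast totalTime_le m n D
  have h2 : (2 * m + 3 : ℝ) * (n + 3) * (m + 1) ^ D =
      Real.exp (Real.log (2 * m + 3) + Real.log (n + 3) + D * Real.log (m + 1)) := by
    rw [Real.exp_add, Real.exp_add, Real.exp_log (by positivity), Real.exp_log (by positivity),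
      ← Real.log_pow, Real.exp_log (by positivity)]
  rw [h2] at h1
  refine h1.trans (Real.exp_le_exp.2 ?_)
  have hlm : 0 ≤ Real.log (m + 1 : ℝ) := Real.log_nonneg (by linarith)
  have hlm' : 0 ≤ Real.log (2 * m + 3 : ℝ) := Real.log_nonneg (by linarith)
  have e1 : Real.log (2 * m + 3) ≤ Real.log (2 * m + 3) / a ^ (l + 1) * L ^ (l + 1) := by
    rw [div_mul_eq_mul_div, le_div_iff₀ (by positivity)]
    gcongr
  have e2 : Real.log (n + 3) ≤ 3 / a ^ l * L ^ (l + 1) := by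
    have h3 : Real.log (n + 3) ≤ 3 * L := by
      -- For `n ≥ 2` one has `n + 3 ≤ n ^ 3`.
      have : Real.log (n + 3) ≤ Real.log ((n : ℝ) ^ 3) := by
        apply Real.log_le_log (by positivity)
        nlinarith [mul_self_nonneg ((n : ℝ) - 2),
          mul_nonneg (sub_nonneg.2 hn') (sq_nonneg (n : ℝ))]
      rwa [Real.log_pow] at this
    refine h3.trans ?_
    rw [div_mul_eq_mul_div, le_div_iff₀ (by positivity), pow_succ']
    have : a ^ l ≤ L ^ l := by gcongr
    calc 3 * L * a ^ l ≤ 3 * L * L ^ l := by gcongr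
      _ = 3 * (L * L ^ l) := by ring
  have e3 : (D : ℝ) * Real.log (m + 1) ≤ Real.log (m + 1) * 8 ^ (l + 1) * L ^ (l + 1) := by
    have h4 : (D : ℝ) ≤ (8 * L) ^ (l + 1) := by
      rw [hD]
      push_cast
      exact pow_le_pow_left₀ (by positivity) (two_mul_clog_add_one_le n hn) _
    rw [mul_pow] at h4
    calc (D : ℝ) * Real.log (m + 1) ≤ (8 ^ (l + 1) * L ^ (l + 1)) * Real.log (m + 1) := by gcongr
      _ = _ := by ring
  rw [add_mul, add_mul]
  linarith

end

/-- The input of the machine is the word over the states of the Hanoi automaton itself, one symbol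
per letter, so that the length of the input is the length of the word. -/
theorem corollary2 (m : ℕ) (hm : 3 ≤ m) :
    (∃ M : Turing.TM2ComputableInTime
        (id : List (HanoiState m) → List (HanoiState m)) Computability.encodeBool
        (hanoiAutomaton_isInvertible m).wordProblem,
      (∀ k, Finite (M.tm.Γ k)) ∧
      ∃ C : ℝ, ∀ n : ℕ, 2 ≤ n →
        (M.time n : ℝ) ≤ Real.exp (C * Real.log n ^ (m - 2))) ∧
    ∀ w : List (HanoiState m),
      (hanoiAutomaton_isInvertible m).eval w = 1 ↔
        ∀ (v : List (Fin m)) (x : Fin m),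
          (hanoiAutomaton m).wordAct ((hanoiAutomaton m).wordSect w v) [x] = [x] := by
  classical
  -- The exponent `m - 2` is at least 1, so `log^(m-2) n` also dominates the logarithm of the linear
  -- factor.
  refine ⟨⟨SectionMachine.computableInTime (hanoiAutomaton m) (hanoiAutomaton_isInvertible m)
    (fun n => (2 * Nat.clog 2 n + 1) ^ (m - 2)) fun w => hanoiAutomaton_depthLE (by omega) w,
    ?_, exists_totalTime_le_exp m (m - 2) (by omega)⟩, fun w => ?_⟩
  · have : Finite (HanoiState m) := inferInstance
    intro k
    change Finite (SectionMachine.Symb (HanoiState m) k)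
    cases k
    · exact inferInstanceAs (Finite (HanoiState m))
    · exact inferInstanceAs (Finite Bool)
    · exact inferInstanceAs (Finite (Option (HanoiState m)))
    · exact inferInstanceAs (Finite (Option (HanoiState m)))
  · rw [MealyAutomaton.IsInvertible.eval_eq_one_iff, MealyAutomaton.wordAct_eq_self_iff]
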